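/- An edge-ordered graph is a finite simple graph together with a total order on its edge set. An embedding of an edge-ordered graph $F$ into an edge-ordered graph $H$ is an injective map $V(F)\to V(H)$ that sends edges to edges and preserves the order of the edges; if one exists, $H$ contains a copy of $F$. A perfect $F$-tiling in $H$ is a collection of vertex-disjoint copies of $F$ in $H$ that covers all vertices of $H$. An edge-ordered graph $F$ on $f$ vertices is tileable if there is a positive integer $t$ divisible by $f$ such that every edge-ordering of the complete graph $K_t$ contains a perfect $F$-tiling. In the min ordering of $K_n$ on $v_1,\dots,v_n$ the edges $v_iv_j$ $(i<j)$ are ordered first by $i$ and then by $j$; in the max ordering they are ordered first by $j$ and then by $i$. A vertex $v$ of an edge-ordered graph $F$ on $n$ vertices is minimal (maximal) if some embedding of $F$ into the min (max) ordering of $K_n$ sends $v$ to $v_1$ (to $v_n$). Let $K_4^-$ be $K_4$ with one edge removed, and let $D_4$ be the edge-ordering $u_1u_2<u_1u_3<u_1u_4<u_2u_4<u_3u_4$ of $K_4^-$. For every $n\ge 6$ there is a connected $n$-vertex tileable edge-ordered graph $F_n$ whose underlying graph contains $K_4^-$. More precisely, there are edge-ordered graphs $F_n$ on $n$ vertices $(n\ge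 4)$ such that: 1. $F_4=D_4$; 2. for every even $n\ge 4$, $F_{n+1}$ arises from $F_n$ by adding a new vertex and joining it to a minimal vertex of $F_n$ by an edge smaller than all edges of $F_n$; 3. for every odd $n\ge 5$, $F_{n+1}$ arises from $F_n$ by adding a new vertex and joining it to a maximal vertex of $F_n$ by an edge larger than all edges of $F_n$; 4. for every $n\ge 6$, $F_n$ is connected and tileable, its underlying graph contains $K_4^-$, and $F_n$ contains a copy of $D_4$. The connected edge-ordered graph $D_4$ is itself not tileable. Consequently tileability is not closed under taking connected subgraphs: there are connected edge-ordered graphs $A$ and $B$ such that $B$ is tileable and contains a copy of $A$, but $A$ is not tileable. -/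

import Mathlib

/-- An edge-ordered graph on the vertex set `V`: a simple graph together with a strict total
order `lt` on its edge set.  (`lt` is a relation on unordered pairs which only relates edges of
the graph, so that it carries no information beyond the order of the edges.) -/
structure EdgeOrderedGraph (V : Type*) where
  graph : SimpleGraph V
  lt : Sym2 V → Sym2 V → Prop
  mem_of_lt : ∀ e e', lt e e' → e ∈ graph.edgeSet ∧ e' ∈ graph.edgeSet
  irrefl : ∀ e, ¬ lt e e
  trans : ∀ e₁ e₂ e₃, lt e₁ e₂ → lt e₂ e₃ → lt e₁ e₃
  total : ∀ e ∈ graph.edgeSet, ∀ e' ∈ graph.edgeSet, e ≠ e' → lt e e' ∨ lt e' e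

namespace EdgeOrderedGraph

/-- The edge-ordering of the graph `G` induced by an injective labeling `L` of its edges. -/
def ofLabeling {V α : Type*} [LinearOrder α] (G : SimpleGraph V) (L : Sym2 V → α)
    (hL : Set.InjOn L G.edgeSet) : EdgeOrderedGraph V where
  graph := G
  lt e e' := e ∈ G.edgeSet ∧ e' ∈ G.edgeSet ∧ L e < L e'
  mem_of_lt _ _ h := ⟨h.1, h.2.1⟩
  irrefl _ h := lt_irrefl _ h.2.2
  trans _ _ _ h h' := ⟨h.1, h'.2.1, lt_trans h.2.2 h'.2.2⟩
  total e he e' he' hne := by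
    rcases lt_trichotomy (L e) (L e') with h | h | h
    · exact Or.inl ⟨he, he', h⟩
    · exact absurd (hL he he' h) hne
    · exact Or.inr ⟨he', he, h⟩

/-- `φ` is an embedding of `F` into `H`: it is injective, maps edges to edges and preserves the
order of the edges. -/
structure IsEmbedding {V W : Type*} (F : EdgeOrderedGraph V) (H : EdgeOrderedGraph W)
    (φ : V → W) : Prop where
  injective : Function.Injective φ
  map_adj : ∀ u v, F.graph.Adj u v → H.graph.Adj (φ u) (φ v)
  map_lt : ∀ e e', F.lt e e' → H.lt (e.map φ) (e'.map φ)

/-- `H` contains a copy of `F`, i.e. `F` is (isomorphic to) an edge-ordered subgraph of `H`. -/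
def ContainsCopy {V W : Type*} (H : EdgeOrderedGraph W) (F : EdgeOrderedGraph V) : Prop :=
  ∃ φ : V → W, IsEmbedding F H φ

/-- `H` contains a perfect `F`-tiling: a collection of vertex-disjoint copies of `F` in `H`
covering all the vertices of `H`. -/
def HasPerfectTiling {V W : Type*} (H : EdgeOrderedGraph W) (F : EdgeOrderedGraph V) : Prop :=
  ∃ T : Set (V → W), (∀ φ ∈ T, IsEmbedding F H φ) ∧
    T.PairwiseDisjoint (fun φ => Set.range φ) ∧ (⋃ φ ∈ T, Set.range φ) = Set.univ

/-- `F` is tileable: for some positive `t` divisible by the number of vertices of `F`, every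
edge-ordering of the complete graph on `t` vertices contains a perfect `F`-tiling. -/
def Tileable {V : Type*} [Fintype V] (F : EdgeOrderedGraph V) : Prop :=
  ∃ t : ℕ, 0 < t ∧ Fintype.card V ∣ t ∧
    ∀ H : EdgeOrderedGraph (Fin t), H.graph = ⊤ → H.HasPerfectTiling F

/-- The min ordering of the complete graph on `v₁, …, vₙ`: edges `vᵢvⱼ` with `i < j` are compared
first by `i` and then by `j`. -/
def minOrdering (n : ℕ) : EdgeOrderedGraph (Fin n) :=
  ofLabeling (⊤ : SimpleGraph (Fin n)) (fun e => toLex (e.inf, e.sup)) (by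
    intro e _ e' _ h
    have h' : (e.inf, e.sup) = (e'.inf, e'.sup) := toLex.injective h
    exact Sym2.inf_eq_inf_and_sup_eq_sup.mp ⟨(Prod.mk.inj h').1, (Prod.mk.inj h').2⟩)

/-- The max ordering of the complete graph on `v₁, …, vₙ`: edges `vᵢvⱼ` with `i < j` are compared
first by `j` and then by `i`. -/
def maxOrdering (n : ℕ) : EdgeOrderedGraph (Fin n) :=
  ofLabeling (⊤ : SimpleGraph (Fin n)) (fun e => toLex (e.sup, e.inf)) (by
    intro e _ e' _ h
    have h' : (e.sup, e.inf) = (e'.sup, e'.inf) := toLex.injective h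
    exact Sym2.inf_eq_inf_and_sup_eq_sup.mp ⟨(Prod.mk.inj h').2, (Prod.mk.inj h').1⟩)

/-- `v` is minimal in `F`: it plays the role of the first vertex in some embedding of `F` into the
min ordering of the complete graph on as many vertices as `F`. -/
def IsMinimalVertex {n : ℕ} (F : EdgeOrderedGraph (Fin n)) (v : Fin n) : Prop :=
  ∃ φ : Fin n → Fin n, IsEmbedding F (minOrdering n) φ ∧ (φ v : ℕ) = 0

/-- `v` is maximal in `F`: it plays the role of the last vertex in some embedding of `F` into the
max ordering of the complete graph on as many vertices as `F`. -/
def IsMaximalVertex {n : ℕ} (F : EdgeOrderedGraph (Fin n)) (v : Fin n) : Prop :=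
  ∃ φ : Fin n → Fin n, IsEmbedding F (maxOrdering n) φ ∧ (φ v : ℕ) + 1 = n

/-- `F'` arises from `F` (embedded by `ι`) by adding one new vertex `u` and the single pendant edge
joining `u` to the vertex `v` of `F`; the edges of `F` keep their order. The position of the new
edge in the order is left open. -/
structure IsPendantExtension {V W : Type*} (F : EdgeOrderedGraph V) (v : V)
    (F' : EdgeOrderedGraph W) (ι : V → W) (u : W) : Prop where
  injective : Function.Injective ι
  range_eq : Set.range ι = {u}ᶜ
  adj_iff : ∀ x y, F'.graph.Adj (ι x) (ι y) ↔ F.graph.Adj x y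
  adj_new_iff : ∀ x, F'.graph.Adj u (ι x) ↔ x = v
  lt_iff : ∀ e e', F'.lt (e.map ι) (e'.map ι) ↔ F.lt e e'

/-- `F'` arises from `F` by adding a new vertex and joining it to the vertex `v` of `F` by a pendant
edge that is smaller than all edges of `F`. -/
def AddsSmallestPendant {V W : Type*} (F : EdgeOrderedGraph V) (v : V)
    (F' : EdgeOrderedGraph W) : Prop :=
  ∃ (ι : V → W) (u : W), IsPendantExtension F v F' ι u ∧
    ∀ e ∈ F.graph.edgeSet, F'.lt s(u, ι v) (e.map ι)

/-- `F'` arises from `F` by adding a new vertex and joining it to the vertex `v` of `F` by a pendant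
edge that is larger than all edges of `F`. -/
def AddsLargestPendant {V W : Type*} (F : EdgeOrderedGraph V) (v : V)
    (F' : EdgeOrderedGraph W) : Prop :=
  ∃ (ι : V → W) (u : W), IsPendantExtension F v F' ι u ∧
    ∀ e ∈ F.graph.edgeSet, F'.lt (e.map ι) s(u, ι v)

/-- The edges of `D₄` in increasing order. -/
def edgesD4 : List (Sym2 (Fin 4)) := [s(0, 1), s(0, 2), s(0, 3), s(1, 3), s(2, 3)]

/-- The edge-ordered graph `D₄` on `u₁, u₂, u₃, u₄` (here `0, 1, 2, 3`), with edges
`u₁u₂ < u₁u₃ < u₁u₄ < u₂u₄ < u₃u₄`. -/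
def D4 : EdgeOrderedGraph (Fin 4) :=
  ofLabeling (SimpleGraph.fromEdgeSet {e | e ∈ edgesD4}) (fun e => edgesD4.idxOf e) (by
    intro e he e' _ h
    rw [SimpleGraph.edgeSet_fromEdgeSet] at he
    exact (List.idxOf_inj he.1).mp h)

end EdgeOrderedGraph

/-- The graph `K₄⁻`: the complete graph on four vertices with one edge removed. -/
def K4Minus : SimpleGraph (Fin 4) := (⊤ : SimpleGraph (Fin 4)).deleteEdges {s(1, 2)}

/-!
Each `Fₙ` is a double broom: an edge `0 (n - 1)` with two common neighbours of its ends, all other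
vertices being leaves at one of the ends, and with the edge order of the min ordering. It is
contained in the triangular book with the same spine, which is why it is easy to embed.

By Ramsey's theorem every large edge-ordered clique contains a set `S` of `2n - 1` vertices such
that the relative order of `ab`, `ac`, `bc` is the same for all `a < b < c` in `S`. Whatever this
order is, any `n` vertices of `S` span a book, and `S` contains two books on `n - 1` vertices, one
lying below the other, such that the end `v` of the lower spine is the start of the upper one.
Given a vertex `x ∉ S`, the edge `xv` lies above the lower book or below the upper one, so it can
play the role of the largest or of the smallest pendant edge of `Fₙ`; the remaining `n` vertices of
`S` span another copy of `Fₙ`. Thus `S` absorbs any single vertex. Taking enough disjoint sets `S`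
to absorb all the vertices that they leave uncovered gives a perfect tiling.

On the other hand, `D₄` is not tileable: if the star at the first vertex of the min ordering is
reversed, no copy of `D₄` covers that vertex.
-/

namespace EdgeOrderedGraph

/-! ### Ramsey theory -/

/-- The arrow relation `N → (m)ʳ` for colours in `κ`: however the `r`-subsets of a linearly ordered
set are coloured, every set of `N` elements has `m` elements whose `r`-subsets share one colour. -/
def RamseyArrow (κ : Type*) (N m r : ℕ) : Prop :=
  ∀ (α : Type) [LinearOrder α] (c : Finset α → κ) (S : Finset α), N ≤ S.card →
    ∃ T ⊆ S, T.card = m ∧ ∃ y, ∀ A ⊆ T, A.card = r → c A = y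

theorem exists_minHomogeneous {κ : Type*} {r : ℕ} (ramsey : ∀ m, ∃ N, RamseyArrow κ N m r) (l : ℕ) :
    ∃ N, ∀ (α : Type) [LinearOrder α] (c : Finset α → κ) (S : Finset α), N ≤ S.card →
      ∃ T ⊆ S, T.card = l ∧ ∃ g : α → κ, ∀ A ⊆ T, A.card = r + 1 →
        ∀ a ∈ A, (∀ b ∈ A, a ≤ b) → c A = g a := by
  induction l with
  | zero =>
    refine ⟨0, fun α _ c S _ => ⟨∅, by simp, rfl, fun _ => c ∅, fun A hA hc => ?_⟩⟩
    simp [Finset.subset_empty.mp hA] at hc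
  | succ l ih =>
    obtain ⟨N₁, hN₁⟩ := ih
    obtain ⟨N₂, hN₂⟩ := ramsey N₁
    refine ⟨N₂ + 1, fun α _ c S hS => ?_⟩
    have hne : S.Nonempty := Finset.card_pos.mp (by lia)
    set v := S.min' hne
    have hvS : v ∈ S := S.min'_mem hne
    obtain ⟨T₂, hT₂, hc₂, y, hy⟩ := hN₂ α (fun A => c (insert v A)) (S.erase v)
      (by rw [Finset.card_erase_of_mem hvS]; lia)
    obtain ⟨T₁, hT₁, hc₁, g, hg⟩ := hN₁ α c T₂ hc₂.ge
    have hvT : v ∉ T₁ := fun h => by simpa using hT₂ (hT₁ h)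
    have hsub : insert v T₁ ⊆ S :=
      Finset.insert_subset hvS ((hT₁.trans hT₂).trans (Finset.erase_subset _ _))
    refine ⟨insert v T₁, hsub, by rw [Finset.card_insert_of_notMem hvT, hc₁],
      Function.update g v y, fun A hA hcA a ha hmin => ?_⟩
    by_cases hvA : v ∈ A
    · obtain rfl : a = v := le_antisymm (hmin v hvA) (S.min'_le a (hsub (hA ha)))
      rw [Function.update_self, ← hy (A.erase v), Finset.insert_erase hvA]
      · exact (Finset.subset_insert_iff.mp hA).trans hT₁
      · rw [Finset.card_erase_of_mem hvA, hcA, Nat.add_sub_cancel]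
    · rw [Function.update_of_ne (ne_of_mem_of_not_mem ha hvA)]
      exact hg A ((Finset.subset_insert_iff_of_notMem hvA).mp hA) hcA a ha hmin

theorem exists_ramseyArrow (κ : Type*) [Finite κ] (r m : ℕ) : ∃ N, RamseyArrow κ N m r := by
  induction r generalizing m with
  | zero =>
    refine ⟨m, fun α _ c S hS => ?_⟩
    obtain ⟨T, hT, hTm⟩ := Finset.exists_subset_card_eq hS
    exact ⟨T, hT, hTm, c ∅, fun A _ hA => by rw [Finset.card_eq_zero.mp hA]⟩
  | succ r ih =>
    classical
    have := Fintype.ofFinite κ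
    obtain ⟨N, hN⟩ := exists_minHomogeneous ih (Fintype.card κ * m)
    refine ⟨N, fun α _ c S hS => ?_⟩
    obtain ⟨T, hT, hcT, g, hg⟩ := hN α c S hS
    have : Nonempty κ := ⟨c ∅⟩
    obtain ⟨y, -, hy⟩ := Finset.exists_le_card_fiber_of_mul_le_card_of_maps_to
      (s := T) (t := Finset.univ) (f := g) (n := m) (fun _ _ => Finset.mem_univ _)
      Finset.univ_nonempty (by rw [hcT, Finset.card_univ])
    obtain ⟨U, hU, hUm⟩ := Finset.exists_subset_card_eq hy
    have hUT : U ⊆ T := hU.trans (Finset.filter_subset _ _)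
    refine ⟨U, hUT.trans hT, hUm, y, fun A hA hcA => ?_⟩
    have hmin := A.min'_mem (Finset.card_pos.mp (by lia))
    rw [hg A (hA.trans hUT) hcA _ hmin fun b hb => A.min'_le b hb]
    exact (Finset.mem_filter.mp (hU (hA hmin))).2

theorem exists_ramsey_triples (κ : Type*) [Finite κ] [Nonempty κ] (m : ℕ) :
    ∃ N, ∀ (α : Type) [LinearOrder α] (f : α → α → α → κ) (S : Finset α), N ≤ S.card →
      ∃ T ⊆ S, T.card = m ∧
        ∃ y, ∀ a ∈ T, ∀ b ∈ T, ∀ c ∈ T, a < b → b < c → f a b c = y := by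
  obtain ⟨N, hN⟩ := exists_ramseyArrow κ 3 m
  refine ⟨N, fun α _ f S hS => ?_⟩
  let colour (A : Finset α) : κ := match A.sort with
    | [a, b, c] => f a b c
    | _ => Classical.arbitrary κ
  obtain ⟨T, hTS, hTm, y, hy⟩ := hN α colour S hS
  refine ⟨T, hTS, hTm, y, fun a ha b hb c hc hab hbc => ?_⟩
  have hsort : ({a, b, c} : Finset α).sort = [a, b, c] := by
    rw [Finset.sort_insert, Finset.sort_insert, Finset.sort_singleton] <;>
      simp [hab.le, hbc.le, (hab.trans hbc).le, hab.ne, hbc.ne, (hab.trans hbc).ne]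
  rw [← hy {a, b, c} (by simp [Finset.insert_subset_iff, ha, hb, hc])
    (Finset.card_eq_three.mpr ⟨a, b, c, hab.ne, (hab.trans hbc).ne, hbc.ne, rfl⟩)]
  simp only [colour, hsort]

/-! ### Restrictions and duals of edge-orderings -/

variable {U V W : Type*}

theorem asymm {H : EdgeOrderedGraph V} {e e' : Sym2 V} (h : H.lt e e') : ¬ H.lt e' e :=
  fun h' => H.irrefl e (H.trans e e' e h h')

theorem lt_or_lt {H : EdgeOrderedGraph V} (hH : H.graph = ⊤) {a b c : V} (hab : a ≠ b)
    (hac : a ≠ c) (hbc : b ≠ c) : H.lt s(a, b) s(a, c) ∨ H.lt s(a, c) s(a, b) :=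
  H.total _ (by simpa [hH] using hab) _ (by simpa [hH] using hac) (Sym2.congr_right.not.mpr hbc)

theorem ext_of_lt {F F' : EdgeOrderedGraph V} (hg : F.graph = F'.graph)
    (h : ∀ e e', F.lt e e' → F'.lt e e') : F = F' := by
  have hlt : F.lt = F'.lt := by
    ext e e'
    refine ⟨h e e', fun h' => ?_⟩
    obtain ⟨he, he'⟩ := F'.mem_of_lt e e' h'
    rw [← hg] at he he'
    have hne : e ≠ e' := fun heq => F'.irrefl e' (heq ▸ h')
    exact (F.total e he e' he' hne).resolve_right fun hgt => asymm h' (h e' e hgt)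
  cases F
  cases F'
  congr

/-- The edge-ordered graph with the reversed order of edges. -/
def dual (H : EdgeOrderedGraph V) : EdgeOrderedGraph V where
  graph := H.graph
  lt e e' := H.lt e' e
  mem_of_lt e e' h := (H.mem_of_lt e' e h).symm
  irrefl := H.irrefl
  trans e₁ e₂ e₃ h h' := H.trans e₃ e₂ e₁ h' h
  total e he e' he' hne := (H.total e he e' he' hne).symm

/-- The edge-ordered subgraph of `H` formed by the edges that also belong to `G`. -/
def restrict (H : EdgeOrderedGraph V) (G : SimpleGraph V) : EdgeOrderedGraph V where
  graph := H.graph ⊓ G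
  lt e e' := e ∈ G.edgeSet ∧ e' ∈ G.edgeSet ∧ H.lt e e'
  mem_of_lt e e' h := by
    obtain ⟨hH, hH'⟩ := H.mem_of_lt e e' h.2.2
    simpa only [SimpleGraph.edgeSet_inf] using ⟨⟨hH, h.1⟩, hH', h.2.1⟩
  irrefl e h := H.irrefl e h.2.2
  trans e₁ e₂ e₃ h h' := ⟨h.1, h'.2.1, H.trans e₁ e₂ e₃ h.2.2 h'.2.2⟩
  total e he e' he' hne := by
    rw [SimpleGraph.edgeSet_inf] at he he'
    exact (H.total e he.1 e' he'.1 hne).imp (fun h => ⟨he.2, he'.2, h⟩) fun h => ⟨he'.2, he.2, h⟩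

theorem IsEmbedding.comp {F : EdgeOrderedGraph U} {H : EdgeOrderedGraph V}
    {K : EdgeOrderedGraph W} {φ : U → V} {ψ : V → W} (hψ : IsEmbedding H K ψ)
    (hφ : IsEmbedding F H φ) : IsEmbedding F K (ψ ∘ φ) where
  injective := hψ.injective.comp hφ.injective
  map_adj u v h := hψ.map_adj _ _ (hφ.map_adj u v h)
  map_lt e e' h := by
    rw [← Sym2.map_map, ← Sym2.map_map]
    exact hψ.map_lt _ _ (hφ.map_lt e e' h)

theorem ContainsCopy.refl (H : EdgeOrderedGraph V) : H.ContainsCopy H :=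
  ⟨id, Function.injective_id, fun _ _ h => h, fun _ _ h => by simpa using h⟩

theorem ContainsCopy.trans {F : EdgeOrderedGraph U} {H : EdgeOrderedGraph V}
    {K : EdgeOrderedGraph W} (hK : K.ContainsCopy H) (hH : H.ContainsCopy F) :
    K.ContainsCopy F := by
  obtain ⟨ψ, hψ⟩ := hK
  obtain ⟨φ, hφ⟩ := hH
  exact ⟨ψ ∘ φ, hψ.comp hφ⟩

theorem IsEmbedding.dual {F : EdgeOrderedGraph U} {H : EdgeOrderedGraph V} {φ : U → V}
    (h : IsEmbedding F H φ) : IsEmbedding F.dual H.dual φ :=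
  ⟨h.injective, h.map_adj, fun e e' hlt => h.map_lt e' e hlt⟩

theorem isEmbedding_of_graph_eq_top {F : EdgeOrderedGraph U} {H : EdgeOrderedGraph V} {φ : U → V}
    (hH : H.graph = ⊤) (hφ : Function.Injective φ)
    (hlt : ∀ e e', F.lt e e' → H.lt (e.map φ) (e'.map φ)) : IsEmbedding F H φ :=
  ⟨hφ, fun _ _ h => by rw [hH]; exact hφ.ne h.ne, hlt⟩

theorem isEmbedding_restrict (H : EdgeOrderedGraph V) (G : SimpleGraph V) :
    IsEmbedding (H.restrict G) H id :=
  ⟨Function.injective_id, fun _ _ h => h.1, fun _ _ h => by simpa using h.2.2⟩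

theorem isEmbedding_restrict_of_le (H : EdgeOrderedGraph V) {G G' : SimpleGraph V} (h : G ≤ G') :
    IsEmbedding (H.restrict G) (H.restrict G') id where
  injective := Function.injective_id
  map_adj _ _ hadj := ⟨hadj.1, h hadj.2⟩
  map_lt _ _ hlt := by
    have hsub := SimpleGraph.edgeSet_mono h
    simpa using ⟨hsub hlt.1, hsub hlt.2.1, hlt.2.2⟩

theorem exists_lt_eq_mk {α : Type*} [LinearOrder α] {e : Sym2 α} (he : ¬ e.IsDiag) :
    ∃ i j, i < j ∧ e = s(i, j) := by
  induction e with
  | _ i j =>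
    rcases lt_or_gt_of_ne (Sym2.mk_isDiag_iff.not.mp he) with h | h
    · exact ⟨i, j, h, rfl⟩
    · exact ⟨j, i, h, Sym2.eq_swap⟩

theorem minOrdering_lt_iff {n : ℕ} {i j k l : Fin n} (hij : i < j) (hkl : k < l) :
    (minOrdering n).lt s(i, j) s(k, l) ↔ i < k ∨ i = k ∧ j < l := by
  simp [minOrdering, ofLabeling, Prod.Lex.toLex_lt_toLex, hij.ne, hkl.ne, hij.le, hkl.le]

theorem maxOrdering_lt_iff {n : ℕ} {i j k l : Fin n} (hij : i < j) (hkl : k < l) :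
    (maxOrdering n).lt s(i, j) s(k, l) ↔ j < l ∨ j = l ∧ i < k := by
  simp [maxOrdering, ofLabeling, Prod.Lex.toLex_lt_toLex, hij.ne, hkl.ne, hij.le, hkl.le]

theorem minOrdering_zero_one_lt {n : ℕ} {e : Sym2 (Fin (n + 2))} (he : ¬ e.IsDiag)
    (hne : e ≠ s(0, 1)) : (minOrdering (n + 2)).lt s(0, 1) e := by
  obtain ⟨i, j, hij, rfl⟩ := exists_lt_eq_mk he
  rw [minOrdering_lt_iff Fin.zero_lt_one hij]
  rcases (Fin.zero_le i).lt_or_eq with hi | rfl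
  · exact Or.inl hi
  · refine Or.inr ⟨rfl, lt_of_le_of_ne (Fin.one_le_of_ne_zero hij.ne') ?_⟩
    rintro rfl
    exact hne rfl

theorem minOrdering_lt_last {n : ℕ} {e : Sym2 (Fin (n + 2))} (he : ¬ e.IsDiag)
    (hne : e ≠ s((Fin.last n).castSucc, Fin.last (n + 1))) :
    (minOrdering (n + 2)).lt e s((Fin.last n).castSucc, Fin.last (n + 1)) := by
  obtain ⟨i, j, hij, rfl⟩ := exists_lt_eq_mk he
  rw [minOrdering_lt_iff hij (Fin.castSucc_lt_last _)]
  simp only [ne_eq, Sym2.eq_iff, Fin.ext_iff, Fin.lt_def, Fin.val_castSucc, Fin.val_last]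
    at hne hij ⊢
  lia

theorem minOrdering_map_lt_map_iff {m n : ℕ} {f : Fin m → Fin n} (hf : StrictMono f)
    {e e' : Sym2 (Fin m)} :
    (minOrdering n).lt (e.map f) (e'.map f) ↔ (minOrdering m).lt e e' := by
  induction e with
  | _ i j =>
    induction e' with
    | _ k l =>
      simp [minOrdering, ofLabeling, Prod.Lex.toLex_lt_toLex, ← hf.monotone.map_inf,
        ← hf.monotone.map_sup, hf.lt_iff_lt, hf.injective.eq_iff]

theorem isEmbedding_restrict_minOrdering {n : ℕ} {G : SimpleGraph (Fin n)}
    {H : EdgeOrderedGraph V} {φ : Fin n → V} (hH : H.graph = ⊤) (hφ : Function.Injective φ)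
    (hlt : ∀ i j k l, i < j → k < l → G.Adj i j → G.Adj k l → i < k ∨ i = k ∧ j < l →
      H.lt s(φ i, φ j) s(φ k, φ l)) : IsEmbedding ((minOrdering n).restrict G) H φ := by
  refine isEmbedding_of_graph_eq_top hH hφ fun e e' ⟨he, he', h⟩ => ?_
  obtain ⟨i, j, hij, rfl⟩ := exists_lt_eq_mk (G.not_isDiag_of_mem_edgeSet he)
  obtain ⟨k, l, hkl, rfl⟩ := exists_lt_eq_mk (G.not_isDiag_of_mem_edgeSet he')
  exact hlt i j k l hij hkl he he' ((minOrdering_lt_iff hij hkl).mp h)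

/-! ### Double brooms and triangular books -/

/-- The double broom on `Fin n`: the vertices `0` and `n - 1` are adjacent and have `k + 1` and
`k + 2` as common neighbours; the vertices `1, …, k` are leaves at `0` and the vertices
`k + 3, …, n - 2` are leaves at `n - 1`. -/
def doubleBroomGraph (k n : ℕ) : SimpleGraph (Fin n) :=
  SimpleGraph.fromRel fun i j => i < j ∧
    ((i : ℕ) = 0 ∧ ((j : ℕ) ≤ k + 2 ∨ (j : ℕ) + 1 = n) ∨ k + 1 ≤ (i : ℕ) ∧ (j : ℕ) + 1 = n)

/-- The double broom with the edge-ordering induced by the min ordering of its vertices. -/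
def doubleBroom (k n : ℕ) : EdgeOrderedGraph (Fin n) :=
  (minOrdering n).restrict (doubleBroomGraph k n)

/-- The triangular book on `Fin n`: the vertices `0` and `n - 1` are joined to all others. -/
def bookGraph (n : ℕ) : SimpleGraph (Fin n) :=
  SimpleGraph.fromRel fun i j => i < j ∧ ((i : ℕ) = 0 ∨ (j : ℕ) + 1 = n)

/-- The triangular book with the edge-ordering induced by the min ordering of its vertices. -/
def book (n : ℕ) : EdgeOrderedGraph (Fin n) :=
  (minOrdering n).restrict (bookGraph n)

theorem doubleBroomGraph_adj {k n : ℕ} {i j : Fin n} (hij : i < j) :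
    (doubleBroomGraph k n).Adj i j ↔
      (i : ℕ) = 0 ∧ ((j : ℕ) ≤ k + 2 ∨ (j : ℕ) + 1 = n) ∨ k + 1 ≤ (i : ℕ) ∧ (j : ℕ) + 1 = n := by
  simp [doubleBroomGraph, hij, hij.ne, hij.not_gt]

theorem bookGraph_adj {n : ℕ} {i j : Fin n} (hij : i < j) :
    (bookGraph n).Adj i j ↔ (i : ℕ) = 0 ∨ (j : ℕ) + 1 = n := by
  simp [bookGraph, hij, hij.ne, hij.not_gt]

theorem doubleBroom_graph (k n : ℕ) : (doubleBroom k n).graph = doubleBroomGraph k n :=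
  top_inf_eq _

theorem isEmbedding_doubleBroom_book (k n : ℕ) : IsEmbedding (doubleBroom k n) (book n) id := by
  refine isEmbedding_restrict_of_le _ ?_
  rintro i j ⟨hne, hij⟩
  exact ⟨hne, hij.imp (And.imp_right (Or.imp And.left And.right))
    (And.imp_right (Or.imp And.left And.right))⟩

theorem doubleBroom_zero_four : doubleBroom 0 4 = D4 := by
  have hgraph : doubleBroomGraph 0 4 = D4.graph := by
    ext a b
    simp only [D4, ofLabeling, doubleBroomGraph, SimpleGraph.fromRel_adj,
      SimpleGraph.fromEdgeSet_adj, edgesD4, Set.mem_ofPred_eq]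
    revert a b
    decide
  refine ext_of_lt ((doubleBroom_graph 0 4).trans hgraph) fun e e' h => ?_
  obtain ⟨he, he', hlt⟩ := h
  obtain ⟨i, j, hij, rfl⟩ := exists_lt_eq_mk (SimpleGraph.not_isDiag_of_mem_edgeSet _ he)
  obtain ⟨k, l, hkl, rfl⟩ := exists_lt_eq_mk (SimpleGraph.not_isDiag_of_mem_edgeSet _ he')
  refine ⟨(hgraph ▸ he : _ ∈ D4.graph.edgeSet), (hgraph ▸ he' : _ ∈ D4.graph.edgeSet), ?_⟩
  rw [minOrdering_lt_iff hij hkl] at hlt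
  rw [SimpleGraph.mem_edgeSet, doubleBroomGraph_adj ‹_›] at he he'
  revert i j k l
  decide

theorem adj_zero_or_last_doubleBroomGraph {k n : ℕ} {i : Fin (n + 1)} (hi : 0 < i)
    (hin : i < Fin.last n) :
    (doubleBroomGraph k (n + 1)).Adj 0 i ∨ (doubleBroomGraph k (n + 1)).Adj i (Fin.last n) := by
  rw [doubleBroomGraph_adj hi, doubleBroomGraph_adj hin]
  simp only [Fin.val_zero, Fin.val_last]
  lia

theorem connected_doubleBroom (k n : ℕ) (hn : 2 ≤ n) : (doubleBroom k n).graph.Connected := by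
  obtain ⟨n, rfl⟩ := Nat.exists_eq_add_of_le' hn
  rw [doubleBroom_graph, SimpleGraph.connected_iff_exists_forall_reachable]
  have hspine : (doubleBroomGraph k (n + 2)).Adj 0 (Fin.last (n + 1)) :=
    (doubleBroomGraph_adj (Fin.last_pos)).mpr (by simp)
  refine ⟨0, fun i => ?_⟩
  rcases (Fin.zero_le i).eq_or_lt with rfl | hi
  · rfl
  rcases (Fin.le_last i).eq_or_lt with rfl | hin
  · exact hspine.reachable
  rcases adj_zero_or_last_doubleBroomGraph hi hin with h | h
  · exact h.reachable
  · exact hspine.reachable.trans h.symm.reachable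

theorem isMinimalVertex_doubleBroom (k n : ℕ) : (doubleBroom k (n + 1)).IsMinimalVertex 0 :=
  ⟨id, isEmbedding_restrict _ _, rfl⟩

theorem isEmbedding_book_iff {n : ℕ} {H : EdgeOrderedGraph V} (hH : H.graph = ⊤)
    {ψ : Fin (n + 1) → V} :
    IsEmbedding (book (n + 1)) H ψ ↔ Function.Injective ψ ∧
      (∀ i j, 0 < i → i < j → H.lt s(ψ 0, ψ i) s(ψ 0, ψ j)) ∧
      ∀ i j, i < j → j < Fin.last n → H.lt s(ψ i, ψ (Fin.last n)) s(ψ j, ψ (Fin.last n)) := by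
  constructor
  · intro hψ
    refine ⟨hψ.injective, fun i j hi hij => hψ.map_lt s(0, i) s(0, j) ⟨?_, ?_, ?_⟩,
      fun i j hij hj => hψ.map_lt s(i, Fin.last n) s(j, Fin.last n) ⟨?_, ?_, ?_⟩⟩
    · exact (bookGraph_adj hi).mpr (by simp)
    · exact (bookGraph_adj (hi.trans hij)).mpr (by simp)
    · exact (minOrdering_lt_iff hi (hi.trans hij)).mpr (Or.inr ⟨rfl, hij⟩)
    · exact (bookGraph_adj (hij.trans hj)).mpr (by simp)
    · exact (bookGraph_adj hj).mpr (by simp)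
    · exact (minOrdering_lt_iff (hij.trans hj) hj).mpr (Or.inl hij)
  · rintro ⟨hψ, hleft, hright⟩
    refine isEmbedding_restrict_minOrdering hH hψ fun i j k l hij hkl haij hakl hlt => ?_
    rw [bookGraph_adj ‹_›] at haij hakl
    rcases (Fin.zero_le k).eq_or_lt with rfl | hk
    · obtain ⟨rfl, hjl⟩ := hlt.resolve_left (Fin.not_lt_zero i)
      exact hleft j l hij hjl
    obtain rfl : l = Fin.last n := Fin.ext (by simp; lia)
    rcases (Fin.zero_le i).eq_or_lt with rfl | hi
    · have hspine := hright 0 k hk hkl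
      rcases (Fin.le_last j).eq_or_lt with rfl | hj
      · exact hspine
      · exact H.trans _ _ _ (hleft j _ hij hj) hspine
    · obtain rfl : j = Fin.last n := Fin.ext (by simp; lia)
      exact hright i k (hlt.resolve_right fun h => h.2.false) hkl

theorem isMaximalVertex_doubleBroom (k n : ℕ) :
    (doubleBroom k (n + 1)).IsMaximalVertex (Fin.last n) := by
  refine ⟨id, ((isEmbedding_book_iff rfl).mpr
    ⟨Function.injective_id, fun i j hi hij => ?_, fun i j hij hj => ?_⟩).comp
    (isEmbedding_doubleBroom_book k (n + 1)), by simp⟩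
  · exact (maxOrdering_lt_iff hi (hi.trans hij)).mpr (Or.inl hij)
  · exact (maxOrdering_lt_iff (hij.trans hj) hj).mpr (Or.inr ⟨rfl, hij⟩)

/-! ### Pendant edges -/

theorem K4Minus_eq_graph_D4 : K4Minus = D4.graph := by
  ext a b
  simp only [K4Minus, D4, ofLabeling, SimpleGraph.deleteEdges_adj, SimpleGraph.top_adj,
    SimpleGraph.fromEdgeSet_adj, edgesD4, Set.mem_singleton_iff, Set.mem_ofPred_eq]
  revert a b
  decide

theorem ContainsCopy.isContained {F : EdgeOrderedGraph U} {H : EdgeOrderedGraph V}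
    (h : H.ContainsCopy F) : F.graph.IsContained H.graph := by
  obtain ⟨φ, hφ⟩ := h
  exact ⟨⟨⟨φ, fun hadj => hφ.map_adj _ _ hadj⟩, hφ.injective⟩⟩

section Pendant

variable {F : EdgeOrderedGraph U} {F' : EdgeOrderedGraph W} {v : U} {ι : U → W} {u : W}

theorem IsPendantExtension.dual (h : IsPendantExtension F v F' ι u) :
    IsPendantExtension F.dual v F'.dual ι u :=
  ⟨h.injective, h.range_eq, h.adj_iff, h.adj_new_iff, fun e e' => h.lt_iff e' e⟩

theorem IsPendantExtension.containsCopy (h : IsPendantExtension F v F' ι u) : F'.ContainsCopy F :=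
  ⟨ι, h.injective, fun x y => (h.adj_iff x y).mpr, fun e e' => (h.lt_iff e e').mpr⟩

theorem AddsLargestPendant.dual (h : F.AddsLargestPendant v F') :
    F.dual.AddsSmallestPendant v F'.dual := by
  obtain ⟨ι, u, hι, hlt⟩ := h
  exact ⟨ι, u, hι.dual, hlt⟩

theorem IsPendantExtension.map_mem_edgeSet (h : IsPendantExtension F v F' ι u) {e : Sym2 U}
    (he : e ∈ F.graph.edgeSet) : e.map ι ∈ F'.graph.edgeSet := by
  induction e with
  | _ a b => exact (h.adj_iff a b).mpr he

theorem IsPendantExtension.map_ne_new (h : IsPendantExtension F v F' ι u) (e : Sym2 U) (w : W) :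
    e.map ι ≠ s(u, w) := by
  intro heq
  obtain ⟨a, -, ha⟩ := Sym2.mem_map.mp (heq ▸ Sym2.mem_mk_left u w)
  exact h.range_eq.subset ⟨a, ha⟩ rfl

theorem IsPendantExtension.eq_new_or_exists (h : IsPendantExtension F v F' ι u) (w : W) :
    w = u ∨ ∃ a, ι a = w := by
  by_cases hw : w = u
  · exact Or.inl hw
  · exact Or.inr (h.range_eq.symm.subset hw)

theorem IsPendantExtension.edge_eq_new_or_exists (h : IsPendantExtension F v F' ι u)
    {e : Sym2 W} (he : e ∈ F'.graph.edgeSet) :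
    e = s(u, ι v) ∨ ∃ d ∈ F.graph.edgeSet, e = d.map ι := by
  induction e with
  | _ a b =>
    rcases h.eq_new_or_exists a with rfl | ⟨a, rfl⟩ <;>
      rcases h.eq_new_or_exists b with rfl | ⟨b, rfl⟩
    · exact absurd rfl he.ne
    · exact Or.inl (by rw [(h.adj_new_iff b).mp he])
    · exact Or.inl (by rw [(h.adj_new_iff a).mp he.symm, Sym2.eq_swap])
    · exact Or.inr ⟨s(a, b), (h.adj_iff a b).mp he, rfl⟩

theorem IsPendantExtension.exists_extend (h : IsPendantExtension F v F' ι u) {φ : U → V} {x : V}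
    (hφ : Function.Injective φ) (hx : x ∉ Set.range φ) :
    ∃ φ' : W → V, Function.Injective φ' ∧ (∀ a, φ' (ι a) = φ a) ∧ φ' u = x ∧
      Set.range φ' = insert x (Set.range φ) := by
  let φ' : W → V := Function.extend ι φ fun _ => x
  have hφ'ι (a : U) : φ' (ι a) = φ a := h.injective.extend_apply φ _ a
  have hφ'u : φ' u = x :=
    Function.extend_apply' φ _ u fun hu => absurd rfl (h.range_eq.subset hu)
  refine ⟨φ', ?_, hφ'ι, hφ'u, ?_⟩
  · intro a b hab
    rcases h.eq_new_or_exists a with rfl | ⟨a, rfl⟩ <;>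
      rcases h.eq_new_or_exists b with rfl | ⟨b, rfl⟩
    · rfl
    · exact absurd ⟨b, by rw [← hφ'ι, ← hab, hφ'u]⟩ hx
    · exact absurd ⟨a, by rw [← hφ'ι, hab, hφ'u]⟩ hx
    · rw [hφ (by rwa [hφ'ι, hφ'ι] at hab : φ a = φ b)]
  · ext y
    constructor
    · rintro ⟨w, rfl⟩
      rcases h.eq_new_or_exists w with rfl | ⟨a, rfl⟩
      · exact Or.inl hφ'u
      · exact Or.inr ⟨a, (hφ'ι a).symm⟩
    · rintro (rfl | ⟨a, rfl⟩)
      exacts [⟨u, hφ'u⟩, ⟨ι a, hφ'ι a⟩]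

theorem AddsSmallestPendant.exists_isEmbedding_insert {H : EdgeOrderedGraph V} {φ : U → V} {x : V}
    (h : F.AddsSmallestPendant v F') (hH : H.graph = ⊤) (hφ : IsEmbedding F H φ)
    (hx : x ∉ Set.range φ) (hlt : ∀ e ∈ F.graph.edgeSet, H.lt s(x, φ v) (e.map φ)) :
    ∃ φ' : W → V, IsEmbedding F' H φ' ∧ Set.range φ' = insert x (Set.range φ) := by
  obtain ⟨ι, u, hι, hnew⟩ := h
  obtain ⟨φ', hφ', hφ'ι, hφ'u, hrange⟩ := hι.exists_extend hφ.injective hx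
  have hmapι (e : Sym2 U) : (e.map ι).map φ' = e.map φ := by
    rw [Sym2.map_map]
    congr 1
    exact funext hφ'ι
  have hmapnew : s(u, ι v).map φ' = s(x, φ v) := by rw [Sym2.map_mk, hφ'u, hφ'ι]
  refine ⟨φ', isEmbedding_of_graph_eq_top hH hφ' fun e e' hee' => ?_, hrange⟩
  obtain ⟨he, he'⟩ := F'.mem_of_lt e e' hee'
  rcases hι.edge_eq_new_or_exists he with rfl | ⟨d, hd, rfl⟩ <;>
    rcases hι.edge_eq_new_or_exists he' with rfl | ⟨d', hd', rfl⟩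
  · exact absurd hee' (F'.irrefl _)
  · rw [hmapι, hmapnew]
    exact hlt d' hd'
  · exact absurd hee' (asymm (hnew d hd))
  · rw [hmapι, hmapι]
    exact hφ.map_lt d d' ((hι.lt_iff d d').mp hee')

theorem AddsLargestPendant.exists_isEmbedding_insert {H : EdgeOrderedGraph V} {φ : U → V} {x : V}
    (h : F.AddsLargestPendant v F') (hH : H.graph = ⊤) (hφ : IsEmbedding F H φ)
    (hx : x ∉ Set.range φ) (hlt : ∀ e ∈ F.graph.edgeSet, H.lt (e.map φ) s(x, φ v)) :
    ∃ φ' : W → V, IsEmbedding F' H φ' ∧ Set.range φ' = insert x (Set.range φ) := by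
  obtain ⟨φ', hφ', hrange⟩ := h.dual.exists_isEmbedding_insert (H := H.dual) hH hφ.dual hx hlt
  exact ⟨φ', hφ'.dual, hrange⟩

end Pendant

theorem isPendantExtension_restrict {n : ℕ} {G : SimpleGraph (Fin n)}
    {G' : SimpleGraph (Fin (n + 1))} {u : Fin (n + 1)} {v : Fin n}
    (hadj : ∀ x y, x < y → (G'.Adj (u.succAbove x) (u.succAbove y) ↔ G.Adj x y))
    (hnew : ∀ x, G'.Adj u (u.succAbove x) ↔ x = v) :
    IsPendantExtension ((minOrdering n).restrict G) v ((minOrdering (n + 1)).restrict G')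
      u.succAbove u := by
  have hadj' (x y) : G'.Adj (u.succAbove x) (u.succAbove y) ↔ G.Adj x y := by
    rcases lt_trichotomy x y with h | rfl | h
    · exact hadj x y h
    · simp
    · rw [G'.adj_comm, G.adj_comm, hadj y x h]
  have hmem (e : Sym2 (Fin n)) : e.map u.succAbove ∈ G'.edgeSet ↔ e ∈ G.edgeSet := by
    induction e with
    | _ x y => exact hadj' x y
  refine ⟨Fin.succAbove_right_injective, Fin.range_succAbove u, fun x y => ?_, fun x => ?_,
    fun e e' => ?_⟩
  · exact and_congr Fin.succAbove_right_injective.ne_iff (hadj' x y)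
  · exact (and_iff_right (Fin.succAbove_ne u x).symm).trans (hnew x)
  · exact and_congr (hmem e) (and_congr (hmem e')
      (minOrdering_map_lt_map_iff (Fin.strictMono_succAbove u)))

theorem addsSmallestPendant_restrict {n : ℕ} {G : SimpleGraph (Fin (n + 1))}
    {G' : SimpleGraph (Fin (n + 2))}
    (hadj : ∀ x y, x < y →
      (G'.Adj (Fin.succAbove 1 x) (Fin.succAbove 1 y) ↔ G.Adj x y))
    (hnew : ∀ x, G'.Adj 1 (Fin.succAbove 1 x) ↔ x = 0) :
    ((minOrdering (n + 1)).restrict G).AddsSmallestPendant 0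
      ((minOrdering (n + 2)).restrict G') := by
  have hι := isPendantExtension_restrict hadj hnew
  refine ⟨_, _, hι, fun e he => ?_⟩
  have he' := hι.map_mem_edgeSet he
  refine ⟨(hnew 0).mpr rfl, SimpleGraph.edgeSet_mono inf_le_right he', ?_⟩
  rw [Fin.succAbove_ne_zero_zero (by simp), Sym2.eq_swap]
  refine minOrdering_zero_one_lt (SimpleGraph.not_isDiag_of_mem_edgeSet _ he') ?_
  rw [Sym2.eq_swap]
  exact hι.map_ne_new e 0

theorem addsLargestPendant_restrict {n : ℕ} {G : SimpleGraph (Fin (n + 1))}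
    {G' : SimpleGraph (Fin (n + 2))}
    (hadj : ∀ x y, x < y →
      (G'.Adj ((Fin.last n).castSucc.succAbove x) ((Fin.last n).castSucc.succAbove y) ↔ G.Adj x y))
    (hnew : ∀ x, G'.Adj (Fin.last n).castSucc ((Fin.last n).castSucc.succAbove x) ↔
      x = Fin.last n) :
    ((minOrdering (n + 1)).restrict G).AddsLargestPendant (Fin.last n)
      ((minOrdering (n + 2)).restrict G') := by
  have hι := isPendantExtension_restrict hadj hnew
  refine ⟨_, _, hι, fun e he => ?_⟩
  have he' := hι.map_mem_edgeSet he
  refine ⟨SimpleGraph.edgeSet_mono inf_le_right he', (hnew _).mpr rfl, ?_⟩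
  rw [Fin.succAbove_castSucc_self, Fin.succ_last]
  exact minOrdering_lt_last (SimpleGraph.not_isDiag_of_mem_edgeSet _ he') (hι.map_ne_new e _)

theorem addsSmallestPendant_doubleBroom (k n : ℕ) :
    (doubleBroom k (n + 2)).AddsSmallestPendant 0 (doubleBroom (k + 1) (n + 3)) := by
  have hval (x : Fin (n + 2)) :
      (Fin.succAbove 1 x : ℕ) = if (x : ℕ) = 0 then 0 else (x : ℕ) + 1 := by
    simp only [Fin.succAbove, Fin.lt_def, Fin.val_castSucc, Fin.val_one, Nat.lt_one_iff]
    split_ifs <;> simp_all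
  refine addsSmallestPendant_restrict (fun x y hxy => ?_) fun x => ?_
  · rw [doubleBroomGraph_adj hxy, doubleBroomGraph_adj (Fin.strictMono_succAbove 1 hxy), hval, hval]
    rw [Fin.lt_def] at hxy
    split_ifs <;> lia
  · rcases (Fin.zero_le x).eq_or_lt with rfl | hx
    · rw [Fin.succAbove_ne_zero_zero (by simp), SimpleGraph.adj_comm,
        doubleBroomGraph_adj Fin.zero_lt_one]
      simp
    · have hlt : 1 < Fin.succAbove 1 x := by
        rw [Fin.lt_def, hval, if_neg (Fin.val_ne_zero_iff.mpr hx.ne')]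
        simpa using hx
      simp [doubleBroomGraph_adj hlt, hx.ne']

theorem addsLargestPendant_doubleBroom {k n : ℕ} (hn : k + 3 ≤ n) :
    (doubleBroom k (n + 1)).AddsLargestPendant (Fin.last n) (doubleBroom k (n + 2)) := by
  have hval (x : Fin (n + 1)) :
      ((Fin.last n).castSucc.succAbove x : ℕ) = if (x : ℕ) = n then n + 1 else x := by
    have := x.is_le
    simp only [Fin.succAbove, Fin.lt_def, Fin.val_castSucc, Fin.val_last]
    split_ifs <;> simp only [Fin.val_succ, Fin.val_castSucc] <;> lia
  refine addsLargestPendant_restrict (fun x y hxy => ?_) fun x => ?_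
  · rw [doubleBroomGraph_adj hxy, doubleBroomGraph_adj (Fin.strictMono_succAbove _ hxy), hval, hval]
    rw [Fin.lt_def] at hxy
    split_ifs <;> lia
  · rcases (Fin.le_last x).eq_or_lt with rfl | hx
    · rw [Fin.succAbove_castSucc_self, Fin.succ_last, doubleBroomGraph_adj (Fin.castSucc_lt_last _)]
      simp only [Fin.val_castSucc, Fin.val_last, or_true, and_true, iff_true]
      lia
    · have hlt : (Fin.last n).castSucc.succAbove x < (Fin.last n).castSucc := by
        rw [Fin.lt_def, hval, if_neg (by simpa using Fin.val_ne_of_ne hx.ne)]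
        exact hx
      rw [SimpleGraph.adj_comm, doubleBroomGraph_adj hlt]
      simp only [Fin.val_eq_zero_iff, Fin.val_castSucc, Fin.val_last, hx.ne, iff_false]
      lia

/-! ### Absorbing sets -/

/-- The vertex set `X` can be tiled with copies of `F` in `H`. -/
def IsTiledSet (H : EdgeOrderedGraph V) (F : EdgeOrderedGraph U) (X : Set V) : Prop :=
  ∃ T : Set (U → V), (∀ φ ∈ T, IsEmbedding F H φ) ∧
    T.PairwiseDisjoint (fun φ => Set.range φ) ∧ (⋃ φ ∈ T, Set.range φ) = X

section Tiling

variable {H : EdgeOrderedGraph V} {F : EdgeOrderedGraph U}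

theorem isTiledSet_empty (H : EdgeOrderedGraph V) (F : EdgeOrderedGraph U) : IsTiledSet H F ∅ :=
  ⟨∅, by simp, by simp, by simp⟩

theorem IsEmbedding.isTiledSet_range {φ : U → V} (h : IsEmbedding F H φ) :
    IsTiledSet H F (Set.range φ) :=
  ⟨{φ}, by simpa using h, by simp, by simp⟩

theorem IsTiledSet.union {X Y : Set V} (hX : IsTiledSet H F X) (hY : IsTiledSet H F Y)
    (hXY : Disjoint X Y) : IsTiledSet H F (X ∪ Y) := by
  obtain ⟨T, hT, hTd, rfl⟩ := hX
  obtain ⟨T', hT', hTd', rfl⟩ := hY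
  refine ⟨T ∪ T', ?_, ?_, Set.biUnion_union _ _ _⟩
  · rintro φ (hφ | hφ)
    exacts [hT φ hφ, hT' φ hφ]
  · refine hTd.union hTd' fun φ hφ φ' hφ' _ => ?_
    exact hXY.mono (Set.subset_biUnion_of_mem (u := fun φ : U → V => Set.range φ) hφ)
      (Set.subset_biUnion_of_mem (u := fun φ : U → V => Set.range φ) hφ')

/-- The vertex set `S` becomes tileable with copies of `F` as soon as any one further vertex is
added to it. -/
def IsAbsorbing (H : EdgeOrderedGraph V) (F : EdgeOrderedGraph U) (S : Finset V) : Prop :=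
  ∀ x ∉ S, IsTiledSet H F (insert x (S : Set V))

theorem exists_reservoir {R m : ℕ}
    (habsorb : ∀ X : Finset V, R ≤ X.card → ∃ S ⊆ X, S.card = m ∧ IsAbsorbing H F S)
    (r : ℕ) (X : Finset V) (hX : R + r * m ≤ X.card) :
    ∃ Z ⊆ X, Z.card = r * m ∧
      ∀ Y : Finset V, Disjoint Z Y → Y.card = r → IsTiledSet H F (Z ∪ Y : Set V) := by
  classical
  induction r generalizing X with
  | zero =>
    refine ⟨∅, X.empty_subset, by simp, fun Y _ hY => ?_⟩
    rw [Finset.card_eq_zero.mp hY]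
    simpa using isTiledSet_empty H F
  | succ r ih =>
    rw [Nat.succ_mul] at hX
    obtain ⟨S, hSX, hSm, hS⟩ := habsorb X (by lia)
    obtain ⟨Z, hZX, hZ, hZY⟩ := ih (X \ S) (by rw [Finset.card_sdiff_of_subset hSX]; lia)
    have hSZ : Disjoint S Z := Finset.disjoint_of_subset_right hZX Finset.disjoint_sdiff
    refine ⟨S ∪ Z, Finset.union_subset hSX (hZX.trans Finset.sdiff_subset), ?_, fun Y hY hYr => ?_⟩
    · rw [Finset.card_union_of_disjoint hSZ, hSm, hZ, Nat.succ_mul, Nat.add_comm]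
    obtain ⟨y, Y, hy, rfl, hYr'⟩ := Finset.card_eq_succ.mp hYr
    rw [Finset.disjoint_union_left, Finset.disjoint_insert_right,
      Finset.disjoint_insert_right] at hY
    obtain ⟨⟨hyS, hSY⟩, hyZ, hZY'⟩ := hY
    have hdisj : Disjoint (insert y (S : Set V)) (Z ∪ Y) := by
      simp [hyZ, hy, hSZ, hSY]
    convert (hS y hyS).union (hZY Y hZY' hYr') hdisj using 1
    rw [Finset.coe_union, Finset.coe_insert, Set.insert_union, Set.union_insert, Set.union_assoc]

end Tiling

theorem tileable_of_exists_isAbsorbing {n m : ℕ} {F : EdgeOrderedGraph (Fin (n + 1))}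
    (hdvd : n + 1 ∣ m + 1) (habsorb : ∃ R, ∀ (t : ℕ) (H : EdgeOrderedGraph (Fin t)), H.graph = ⊤ →
      ∀ X : Finset (Fin t), R ≤ X.card → ∃ S ⊆ X, S.card = m ∧ IsAbsorbing H F S) : F.Tileable := by
  obtain ⟨R, hR⟩ := habsorb
  refine ⟨(R + 1) * (m + 1), by positivity, ?_, fun H hH => ?_⟩
  · rw [Fintype.card_fin]
    exact hdvd.mul_left _
  obtain ⟨Z, -, hZ, htiled⟩ := exists_reservoir (hR _ H hH) (R + 1) Finset.univ (by
    rw [Finset.card_univ, Fintype.card_fin]; lia)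
  have hcard : Zᶜ.card = R + 1 := by
    rw [Finset.card_compl, Fintype.card_fin, hZ]
    lia
  simpa [HasPerfectTiling, IsTiledSet] using htiled Zᶜ disjoint_compl_right hcard

theorem IsEmbedding.lt_map_of_lt_first {n : ℕ} {G : SimpleGraph (Fin (n + 2))}
    {H : EdgeOrderedGraph V} {φ : Fin (n + 2) → V} {d : Sym2 V}
    (hφ : IsEmbedding ((minOrdering (n + 2)).restrict G) H φ) (hG : G.Adj 0 1)
    (hd : H.lt d s(φ 0, φ 1)) :
    ∀ e ∈ ((minOrdering (n + 2)).restrict G).graph.edgeSet, H.lt d (e.map φ) := by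
  intro e he
  by_cases hne : e = s(0, 1)
  · rwa [hne]
  · exact H.trans _ _ _ hd (hφ.map_lt s(0, 1) e ⟨hG, SimpleGraph.edgeSet_mono inf_le_right he,
      minOrdering_zero_one_lt (SimpleGraph.not_isDiag_of_mem_edgeSet _ he) hne⟩)

theorem IsEmbedding.map_lt_of_last_lt {n : ℕ} {G : SimpleGraph (Fin (n + 2))}
    {H : EdgeOrderedGraph V} {φ : Fin (n + 2) → V} {d : Sym2 V}
    (hφ : IsEmbedding ((minOrdering (n + 2)).restrict G) H φ)
    (hG : G.Adj (Fin.last n).castSucc (Fin.last (n + 1)))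
    (hd : H.lt s(φ (Fin.last n).castSucc, φ (Fin.last (n + 1))) d) :
    ∀ e ∈ ((minOrdering (n + 2)).restrict G).graph.edgeSet, H.lt (e.map φ) d := by
  intro e he
  by_cases hne : e = s((Fin.last n).castSucc, Fin.last (n + 1))
  · rwa [hne]
  · exact H.trans _ _ _ (hφ.map_lt e _ ⟨SimpleGraph.edgeSet_mono inf_le_right he, hG,
      minOrdering_lt_last (SimpleGraph.not_isDiag_of_mem_edgeSet _ he) hne⟩) hd

/-- The set `S` is rich in triangular books of `H`: every `m + 3` of its vertices span one, and it
contains two books on `m + 2` vertices, all edges of the one lying below all edges of the other,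
such that the last vertex of the lower book is the first vertex of the upper one. It suffices to
compare the largest edge of the lower book with the smallest edge of the upper one. -/
structure IsBookRich (H : EdgeOrderedGraph V) (m : ℕ) (S : Finset V) : Prop where
  spanning : ∀ X ⊆ S, X.card = m + 3 →
    ∃ ψ : Fin (m + 3) → V, IsEmbedding (book (m + 3)) H ψ ∧ Set.range ψ = X
  pair : ∃ p q : Fin (m + 2) → V,
    (IsEmbedding (book (m + 2)) H p ∧ ∀ i, p i ∈ S) ∧
    (IsEmbedding (book (m + 2)) H q ∧ ∀ i, q i ∈ S) ∧
    p (Fin.last (m + 1)) = q 0 ∧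
    H.lt s(p (Fin.last m).castSucc, p (Fin.last (m + 1))) s(q 0, q 1)

theorem IsBookRich.isTiledSet_insert {H : EdgeOrderedGraph V} {m k : ℕ} {S : Finset V} {x : V}
    (h : IsBookRich H m S) (hS : S.card = 2 * m + 5) (hx : x ∉ S) {p : Fin (m + 2) → V}
    (hp : Function.Injective p) (hpS : ∀ i, p i ∈ S)
    (hpx : ∃ φ, IsEmbedding (doubleBroom k (m + 3)) H φ ∧ Set.range φ = insert x (Set.range p)) :
    IsTiledSet H (doubleBroom k (m + 3)) (insert x (S : Set V)) := by
  classical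
  obtain ⟨φ, hφ, hφr⟩ := hpx
  have hsub : Finset.univ.image p ⊆ S := by simpa [Finset.image_subset_iff] using hpS
  have hcard : (S \ Finset.univ.image p).card = m + 3 := by
    rw [Finset.card_sdiff_of_subset hsub, Finset.card_image_of_injective _ hp, Finset.card_fin, hS]
    lia
  obtain ⟨ψ, hψ, hψr⟩ := h.spanning _ Finset.sdiff_subset hcard
  rw [Finset.coe_sdiff, Finset.coe_image, Finset.coe_univ, Set.image_univ] at hψr
  have hrange : Set.range p ⊆ S := Set.range_subset_iff.mpr hpS
  have htiled := hφ.isTiledSet_range.union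
    (hψ.comp (isEmbedding_doubleBroom_book k (m + 3))).isTiledSet_range
    (by simpa [hφr, hψr, hx] using Set.disjoint_sdiff_right)
  rwa [Function.comp_id, hφr, hψr, Set.insert_union, Set.union_sdiff_cancel hrange] at htiled

theorem IsBookRich.isAbsorbing {H : EdgeOrderedGraph V} {m k : ℕ} {S : Finset V}
    (h : IsBookRich H m S) (hH : H.graph = ⊤) (hS : S.card = 2 * m + 5) (hkm : k + 3 ≤ m) :
    IsAbsorbing H (doubleBroom (k + 1) (m + 3)) S := by
  intro x hx
  obtain ⟨p, q, ⟨hp, hpS⟩, ⟨hq, hqS⟩, hpq, hlt⟩ := h.pair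
  have hxp : x ∉ Set.range p := by rintro ⟨i, rfl⟩; exact hx (hpS i)
  have hxq : x ∉ Set.range q := by rintro ⟨i, rfl⟩; exact hx (hqS i)
  rcases lt_or_lt hH (hq.injective.ne Fin.zero_ne_one) (fun h => hxq ⟨0, h⟩)
    (fun h => hxq ⟨1, h⟩) with hqx | hqx
  · -- the edge from the common vertex to `x` is above the lower book
    refine h.isTiledSet_insert hS hx hp.injective hpS ?_
    have hbroom := hp.comp (isEmbedding_doubleBroom_book (k + 1) (m + 2))
    refine (addsLargestPendant_doubleBroom (by lia)).exists_isEmbedding_insert hH hbroom hxp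
      (hbroom.map_lt_of_last_lt ?_ ?_)
    · rw [doubleBroomGraph_adj (Fin.castSucc_lt_last _)]
      simp only [Fin.val_castSucc, Fin.val_last, and_true]
      lia
    · rw [Sym2.eq_swap (a := x)]
      exact hpq ▸ H.trans _ _ _ hlt hqx
  · refine h.isTiledSet_insert hS hx hq.injective hqS ?_
    have hbroom := hq.comp (isEmbedding_doubleBroom_book k (m + 2))
    refine (addsSmallestPendant_doubleBroom k m).exists_isEmbedding_insert hH hbroom hxq
      (hbroom.lt_map_of_lt_first ?_ ?_)
    · rw [doubleBroomGraph_adj Fin.zero_lt_one]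
      simp
    · rw [Sym2.eq_swap (a := x)]
      exact hqx

theorem isEmbedding_book_comp_rev {H : EdgeOrderedGraph V} (hH : H.graph = ⊤) {n : ℕ}
    {ψ : Fin (n + 1) → V} (hψ : IsEmbedding (book (n + 1)) H.dual ψ) :
    IsEmbedding (book (n + 1)) H (ψ ∘ Fin.rev) := by
  obtain ⟨hinj, hleft, hright⟩ := (isEmbedding_book_iff (H := H.dual) hH).mp hψ
  refine (isEmbedding_book_iff hH).mpr ⟨hinj.comp Fin.rev_injective, fun i j hi hij => ?_,
    fun i j hij hj => ?_⟩
  · simp only [Function.comp_apply, Fin.rev_zero, Sym2.eq_swap (a := ψ (Fin.last n))]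
    exact hright _ _ (Fin.rev_lt_rev.mpr hij) (Fin.rev_zero n ▸ Fin.rev_lt_rev.mpr hi)
  · simp only [Function.comp_apply, Fin.rev_last, Sym2.eq_swap (b := ψ 0)]
    exact hleft _ _ (Fin.rev_last n ▸ Fin.rev_lt_rev.mpr hj) (Fin.rev_lt_rev.mpr hij)

theorem IsBookRich.of_dual {H : EdgeOrderedGraph V} {m : ℕ} {S : Finset V} (hH : H.graph = ⊤)
    (h : IsBookRich H.dual m S) : IsBookRich H m S where
  spanning X hX hcard := by
    obtain ⟨ψ, hψ, hψX⟩ := h.spanning X hX hcard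
    exact ⟨ψ ∘ Fin.rev, isEmbedding_book_comp_rev hH hψ, by
      rw [Fin.rev_surjective.range_comp, hψX]⟩
  pair := by
    obtain ⟨p, q, ⟨hp, hpS⟩, ⟨hq, hqS⟩, hpq, hlt⟩ := h.pair
    refine ⟨q ∘ Fin.rev, p ∘ Fin.rev, ⟨isEmbedding_book_comp_rev hH hq, fun i => hqS _⟩,
      ⟨isEmbedding_book_comp_rev hH hp, fun i => hpS _⟩, by simp [hpq], ?_⟩
    have hone : Fin.rev (1 : Fin (m + 2)) = (Fin.last m).castSucc := by
      simp [Fin.ext_iff, Fin.val_rev]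
    have hlast : Fin.rev (Fin.last m).castSucc = 1 := by rw [← hone, Fin.rev_rev]
    simp only [Function.comp_apply, Fin.rev_last, Fin.rev_zero, hone, hlast]
    rw [Sym2.eq_swap, Sym2.eq_swap (b := p _)]
    exact hlt

/-! ### Homogeneous sets -/

section Homogeneous

variable [LinearOrder V] {H : EdgeOrderedGraph V} {S : Finset V} {m n : ℕ} {f : Fin (n + 1) → V}

/-- The relation `P` holds on all increasing triples of vertices from `S`. -/
def OnTriples (S : Finset V) (P : V → V → V → Prop) : Prop :=
  ∀ a ∈ S, ∀ b ∈ S, ∀ c ∈ S, a < b → b < c → P a b c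

theorem isEmbedding_book_of_onTriples (hH : H.graph = ⊤) (hf : StrictMono f) (hfS : ∀ i, f i ∈ S)
    (hleft : OnTriples S fun a b c => H.lt s(a, b) s(a, c))
    (hright : OnTriples S fun a b c => H.lt s(a, c) s(b, c)) : IsEmbedding (book (n + 1)) H f :=
  (isEmbedding_book_iff hH).mpr ⟨hf.injective,
    fun _ _ hi hij => hleft _ (hfS _) _ (hfS _) _ (hfS _) (hf hi) (hf hij),
    fun _ _ hij hj => hright _ (hfS _) _ (hfS _) _ (hfS _) (hf hij) (hf hj)⟩

-- The pages of this book are attached to its spine, the edge between the two smallest vertices,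
-- in decreasing order.
theorem isEmbedding_book_comp_neg_of_onTriples (hH : H.graph = ⊤) (hf : StrictMono f)
    (hfS : ∀ i, f i ∈ S) (hleft : OnTriples S fun a b c => H.lt s(a, c) s(a, b))
    (hpath : OnTriples S fun a b c => H.lt s(a, b) s(b, c)) :
    IsEmbedding (book (n + 1)) H fun i => f (-i) := by
  have hneg : ∀ {i j : Fin (n + 1)}, 0 < i → i < j → -j < -i := by
    intro i j hi hij
    rw [Fin.lt_def, Fin.val_neg, Fin.val_neg, if_neg hi.ne', if_neg (hi.trans hij).ne']
    lia
  refine (isEmbedding_book_iff hH).mpr ⟨hf.injective.comp neg_injective, fun i j hi hij => ?_,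
    fun i j hij hj => ?_⟩
  · have hj : 0 < -j := Fin.pos_of_ne_zero (neg_ne_zero.mpr (hi.trans hij).ne')
    simpa using hleft _ (hfS 0) _ (hfS _) _ (hfS _) (hf hj) (hf (hneg hi hij))
  · have hone : 1 < -j := Fin.neg_last n ▸ hneg ((Fin.zero_le i).trans_lt hij) hj
    simp only [Fin.neg_last]
    rw [Sym2.eq_swap (a := f (-j))]
    rcases (Fin.zero_le i).eq_or_lt with rfl | hi
    · have hzero : (0 : Fin (n + 1)) < 1 := by
        rw [← Fin.neg_last]
        exact Fin.pos_of_ne_zero (neg_ne_zero.mpr (hij.trans hj).ne')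
      simpa using hpath _ (hfS 0) _ (hfS 1) _ (hfS _) (hf hzero) (hf hone)
    · rw [Sym2.eq_swap]
      exact hleft _ (hfS 1) _ (hfS _) _ (hfS _) (hf hone) (hf (hneg hi hij))

theorem isBookRich_of_onTriples (hH : H.graph = ⊤) (hS : S.card = 2 * m + 5)
    (hleft : OnTriples S fun a b c => H.lt s(a, b) s(a, c))
    (hright : OnTriples S fun a b c => H.lt s(a, c) s(b, c)) : IsBookRich H m S where
  spanning X hX hcard := by
    refine ⟨X.orderEmbOfFin hcard, isEmbedding_book_of_onTriples hH
      (X.orderEmbOfFin hcard).strictMono (fun i => hX (X.orderEmbOfFin_mem hcard i)) hleft hright,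
      X.range_orderEmbOfFin hcard⟩
  pair := by
    let f := S.orderEmbOfFin hS
    have hf : StrictMono f := f.strictMono
    have hfS : ∀ i, f i ∈ S := S.orderEmbOfFin_mem hS
    let p (i : Fin (m + 2)) : V := f ⟨i, by lia⟩
    let q (i : Fin (m + 2)) : V := f ⟨m + 1 + i, by lia⟩
    have hp : StrictMono p := fun i j hij => hf (Fin.mk_lt_mk.mpr hij)
    have hq : StrictMono q := fun i j hij => hf (Fin.mk_lt_mk.mpr (Nat.add_lt_add_left hij _))
    have hpq : p (Fin.last (m + 1)) = q 0 := by simp [p, q]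
    refine ⟨p, q, ⟨isEmbedding_book_of_onTriples hH hp (fun i => hfS _) hleft hright,
      fun i => hfS _⟩, ⟨isEmbedding_book_of_onTriples hH hq (fun i => hfS _) hleft hright,
      fun i => hfS _⟩, hpq, ?_⟩
    have hp' : p (Fin.last m).castSucc < q 0 := hpq ▸ hp (Fin.castSucc_lt_last _)
    have hq' : q 0 < q 1 := hq Fin.zero_lt_one
    rw [hpq]
    exact H.trans _ _ _ (hleft _ (hfS _) _ (hfS _) _ (hfS _) hp' hq')
      (hright _ (hfS _) _ (hfS _) _ (hfS _) hp' hq')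

theorem isBookRich_of_onTriples_path (hH : H.graph = ⊤) (hm : 0 < m) (hS : S.card = 2 * m + 5)
    (hleft : OnTriples S fun a b c => H.lt s(a, c) s(a, b))
    (hpath : OnTriples S fun a b c => H.lt s(a, b) s(b, c)) : IsBookRich H m S where
  spanning X hX hcard := by
    refine ⟨fun i => X.orderEmbOfFin hcard (-i), isEmbedding_book_comp_neg_of_onTriples hH
      (X.orderEmbOfFin hcard).strictMono (fun i => hX (X.orderEmbOfFin_mem hcard i)) hleft hpath,
      ?_⟩
    rw [← X.range_orderEmbOfFin hcard]
    exact neg_surjective.range_comp _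
  pair := by
    obtain ⟨m, rfl⟩ := Nat.exists_eq_add_of_lt hm
    rw [Nat.zero_add] at *
    let f := S.orderEmbOfFin hS
    have hf : StrictMono f := f.strictMono
    have hfS : ∀ i, f i ∈ S := S.orderEmbOfFin_mem hS
    -- both books have `f 1` in their spine; the pages of the lower one come after those of the
    -- upper one
    let p (i : Fin (m + 3)) : V := f ⟨if (i : ℕ) ≤ 1 then i else m + 2 + i, by split <;> lia⟩
    let q (i : Fin (m + 3)) : V := f ⟨i + 1, by lia⟩
    have hp : StrictMono p := fun i j hij => hf (Fin.mk_lt_mk.mpr (by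
      rw [Fin.lt_def] at hij
      split <;> split <;> lia))
    have hq : StrictMono q := fun i j hij => hf (Fin.mk_lt_mk.mpr (Nat.succ_lt_succ hij))
    have hpq : p 1 = q 0 := by simp [p, q]
    have hone : -(1 : Fin (m + 3)) = Fin.last (m + 2) := by rw [← Fin.neg_last, neg_neg]
    have hsnd : -(Fin.last (m + 1)).castSucc = ⟨2, by lia⟩ := by
      simp [Fin.ext_iff, Fin.val_neg]
    refine ⟨fun i => p (-i), fun i => q (-i),
      ⟨isEmbedding_book_comp_neg_of_onTriples hH hp (fun i => hfS _) hleft hpath, fun i => hfS _⟩,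
      ⟨isEmbedding_book_comp_neg_of_onTriples hH hq (fun i => hfS _) hleft hpath, fun i => hfS _⟩,
      by simp [Fin.neg_last, hpq], ?_⟩
    simp only [Fin.neg_last, hone, hsnd, neg_zero, hpq]
    rw [Sym2.eq_swap]
    refine hleft _ (hfS _) _ (hfS _) _ (hfS _) (hq (Fin.last_pos)) (hf (Fin.mk_lt_mk.mpr ?_))
    simp

/-- On increasing triples `a < b < c` of vertices from `S`, the relative order in `H` of the edges
`ab`, `ac`, `bc` does not depend on the triple. -/
structure IsHomogeneous (H : EdgeOrderedGraph V) (S : Finset V) : Prop where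
  left : (OnTriples S fun a b c => H.lt s(a, b) s(a, c)) ∨
    OnTriples S fun a b c => H.lt s(a, c) s(a, b)
  right : (OnTriples S fun a b c => H.lt s(a, c) s(b, c)) ∨
    OnTriples S fun a b c => H.lt s(b, c) s(a, c)
  path : (OnTriples S fun a b c => H.lt s(a, b) s(b, c)) ∨
    OnTriples S fun a b c => H.lt s(b, c) s(a, b)

theorem IsHomogeneous.dual (h : IsHomogeneous H S) : IsHomogeneous H.dual S :=
  ⟨h.left.symm, h.right.symm, h.path.symm⟩

theorem IsHomogeneous.isBookRich_of_right (h : IsHomogeneous H S) (hH : H.graph = ⊤) (hm : 0 < m)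
    (hS : S.card = 2 * m + 5) (hright : OnTriples S fun a b c => H.lt s(a, c) s(b, c)) :
    IsBookRich H m S := by
  rcases h.left with hleft | hleft
  · exact isBookRich_of_onTriples hH hS hleft hright
  rcases h.path with hpath | hpath
  · exact isBookRich_of_onTriples_path hH hm hS hleft hpath
  -- reversing the order of the vertices exchanges the roles of `ab` and `bc`
  · have hleft' : OnTriples S fun a b c => H.lt s(c, a) s(c, b) := by
      simpa only [Sym2.eq_swap] using hright
    have hpath' : OnTriples S fun a b c => H.lt s(c, b) s(b, a) := by
      simpa only [Sym2.eq_swap] using hpath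
    exact isBookRich_of_onTriples_path (V := Vᵒᵈ) hH hm hS
      (fun c hc b hb a ha hbc hab => hleft' a ha b hb c hc hab hbc)
      fun c hc b hb a ha hbc hab => hpath' a ha b hb c hc hab hbc

theorem IsHomogeneous.isBookRich (h : IsHomogeneous H S) (hH : H.graph = ⊤) (hm : 0 < m)
    (hS : S.card = 2 * m + 5) : IsBookRich H m S := by
  rcases h.right with hright | hright
  · exact h.isBookRich_of_right hH hm hS hright
  · exact (h.dual.isBookRich_of_right hH hm hS hright).of_dual hH

theorem onTriples_or_onTriples {P Q : V → V → V → Prop} {y : Prop}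
    (hy : OnTriples S fun a b c => P a b c ↔ y) (hPQ : OnTriples S fun a b c => P a b c ∨ Q a b c) :
    OnTriples S P ∨ OnTriples S Q := by
  by_cases h : y
  · exact Or.inl fun a ha b hb c hc hab hbc => (hy a ha b hb c hc hab hbc).mpr h
  · exact Or.inr fun a ha b hb c hc hab hbc =>
      (hPQ a ha b hb c hc hab hbc).resolve_left ((hy a ha b hb c hc hab hbc).not.mpr h)

end Homogeneous

theorem exists_isHomogeneous (m : ℕ) : ∃ R, ∀ (V : Type) [LinearOrder V] (H : EdgeOrderedGraph V),
    H.graph = ⊤ → ∀ X : Finset V, R ≤ X.card → ∃ S ⊆ X, S.card = m ∧ IsHomogeneous H S := by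
  obtain ⟨R, hR⟩ := exists_ramsey_triples (Prop × Prop × Prop) m
  refine ⟨R, fun V _ H hH X hX => ?_⟩
  obtain ⟨S, hSX, hS, ⟨l, r, p⟩, hy⟩ := hR V (fun a b c =>
    (H.lt s(a, b) s(a, c), H.lt s(a, c) s(b, c), H.lt s(a, b) s(b, c))) X hX
  simp only [Prod.mk.injEq, eq_iff_iff] at hy
  refine ⟨S, hSX, hS, ?_, ?_, ?_⟩
  · exact onTriples_or_onTriples (fun a ha b hb c hc hab hbc => (hy a ha b hb c hc hab hbc).1)
      fun a _ b _ c _ hab hbc => lt_or_lt hH hab.ne (hab.trans hbc).ne hbc.ne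
  · refine onTriples_or_onTriples (fun a ha b hb c hc hab hbc => (hy a ha b hb c hc hab hbc).2.1)
      fun a _ b _ c _ hab hbc => ?_
    simpa only [Sym2.eq_swap] using lt_or_lt hH (hab.trans hbc).ne' hbc.ne' hab.ne
  · refine onTriples_or_onTriples (fun a ha b hb c hc hab hbc => (hy a ha b hb c hc hab hbc).2.2)
      fun a _ b _ c _ hab hbc => ?_
    simpa only [Sym2.eq_swap] using lt_or_lt hH hab.ne' hbc.ne (hab.trans hbc).ne

theorem tileable_doubleBroom {k n : ℕ} (hk : 1 ≤ k) (hkn : k + 5 ≤ n) :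
    (doubleBroom k n).Tileable := by
  obtain ⟨k, rfl⟩ := Nat.exists_eq_add_of_le' hk
  obtain ⟨m, rfl⟩ := Nat.exists_eq_add_of_le' (show 3 ≤ n by lia)
  obtain ⟨R, hR⟩ := exists_isHomogeneous (2 * m + 5)
  refine tileable_of_exists_isAbsorbing (m := 2 * m + 5) ⟨2, by ring⟩
    ⟨R, fun t H hH X hX => ?_⟩
  obtain ⟨S, hSX, hS, hhom⟩ := hR (Fin t) H hH X hX
  exact ⟨S, hSX, hS, (hhom.isBookRich hH (by lia) hS).isAbsorbing hH hS (by lia)⟩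

/-! ### The graph D₄ is not tileable -/

/-- The min ordering with the order of the edges at the first vertex reversed. -/
def reversedFirst (n : ℕ) : EdgeOrderedGraph (Fin n) :=
  ofLabeling ⊤ (fun e => toLex (e.inf, if (e.inf : ℕ) = 0 then -(e.sup : ℤ) else e.sup)) (by
    intro e _ e' _ h
    obtain ⟨hinf, hsup⟩ := Prod.mk.inj (toLex.injective h)
    refine Sym2.inf_eq_inf_and_sup_eq_sup.mp ⟨hinf, Fin.ext ?_⟩
    rw [hinf] at hsup
    split at hsup <;> lia)

theorem reversedFirst_lt_iff {n : ℕ} {i j k l : Fin (n + 1)} (hij : i < j) (hkl : k < l) :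
    (reversedFirst (n + 1)).lt s(i, j) s(k, l) ↔
      i < k ∨ i = k ∧ if k = 0 then l < j else j < l := by
  simp only [reversedFirst, ofLabeling, SimpleGraph.mem_edgeSet, SimpleGraph.top_adj, ne_eq,
    hij.ne, hkl.ne, not_false_eq_true, true_and, Prod.Lex.toLex_lt_toLex, Sym2.inf_mk,
    Sym2.sup_mk, inf_of_le_left hij.le, inf_of_le_left hkl.le, sup_of_le_right hij.le,
    sup_of_le_right hkl.le, Fin.val_eq_zero_iff]
  refine or_congr_right (and_congr_right fun hik => ?_)
  subst hik
  split <;> simp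

theorem not_reversedFirst_lt {n : ℕ} {a b c : Fin (n + 1)} (hb : b ≠ 0) (hc : c ≠ 0) :
    ¬ (reversedFirst (n + 1)).lt s(b, c) s(0, a) := by
  intro h
  obtain ⟨hbc, ha⟩ := (reversedFirst (n + 1)).mem_of_lt _ _ h
  rw [SimpleGraph.mem_edgeSet] at hbc ha
  wlog hlt : b < c generalizing b c
  · exact this hc hb (Sym2.eq_swap ▸ h) hbc.symm (lt_of_le_of_ne (not_lt.mp hlt) hbc.ne')
  rw [reversedFirst_lt_iff hlt (Fin.pos_of_ne_zero ha.ne')] at h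
  exact h.elim (Fin.not_lt_zero b) fun h => hb h.1

theorem D4_lt_iff {e e' : Sym2 (Fin 4)} :
    D4.lt e e' ↔ e ∈ edgesD4 ∧ e' ∈ edgesD4 ∧ edgesD4.idxOf e < edgesD4.idxOf e' := by
  have hdiag : ∀ d ∈ edgesD4, ¬ d.IsDiag := by decide
  simp only [D4, ofLabeling, SimpleGraph.edgeSet_fromEdgeSet]
  constructor
  · exact fun ⟨he, he', h⟩ => ⟨he.1, he'.1, h⟩
  · exact fun ⟨he, he', h⟩ => ⟨⟨he, hdiag e he⟩, ⟨he', hdiag e' he'⟩, h⟩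

theorem IsEmbedding.ne_zero_of_reversedFirst {n : ℕ} {φ : Fin 4 → Fin (n + 1)}
    (hφ : IsEmbedding D4 (reversedFirst (n + 1)) φ) (u : Fin 4) : φ u ≠ 0 := by
  intro hu
  have h₁ := hφ.map_lt s(0, 1) s(0, 2) (D4_lt_iff.mpr (by decide))
  have h₂ := hφ.map_lt s(0, 2) s(0, 3) (D4_lt_iff.mpr (by decide))
  have h₃ := hφ.map_lt s(0, 3) s(1, 3) (D4_lt_iff.mpr (by decide))
  have h₄ := hφ.map_lt s(1, 3) s(2, 3) (D4_lt_iff.mpr (by decide))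
  have hne {v : Fin 4} (hv : v ≠ u) : φ v ≠ 0 := hu ▸ hφ.injective.ne hv
  have hpos {v : Fin 4} (hv : v ≠ u) : 0 < φ v := Fin.pos_of_ne_zero (hne hv)
  simp only [Sym2.map_mk] at h₁ h₂ h₃ h₄
  fin_cases u <;> simp only [Fin.zero_eta, Fin.mk_one, Fin.reduceFinMk] at hu hne hpos
  · have h₁' : φ 2 < φ 1 := by
      simpa [hu, reversedFirst_lt_iff (hpos _) (hpos _)] using h₁
    have h₂' : φ 3 < φ 2 := by
      simpa [hu, reversedFirst_lt_iff (hpos _) (hpos _)] using h₂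
    rw [Sym2.eq_swap, Sym2.eq_swap (a := φ 2),
      reversedFirst_lt_iff (h₂'.trans h₁') h₂', if_neg (hne (by decide))] at h₄
    exact h₄.elim (lt_irrefl _) fun h => h₁'.asymm h.2
  · exact not_reversedFirst_lt (hne (by decide)) (hne (by decide)) (hu ▸ h₃)
  · exact not_reversedFirst_lt (hne (by decide)) (hne (by decide)) (hu ▸ h₄)
  · rw [Sym2.eq_swap (b := φ 3)] at h₂
    exact not_reversedFirst_lt (hne (by decide)) (hne (by decide)) (hu ▸ h₂)

theorem not_tileable_D4 : ¬ D4.Tileable := by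
  rintro ⟨t, ht, -, h⟩
  obtain ⟨t, rfl⟩ := Nat.exists_eq_add_of_le' ht
  obtain ⟨T, hT, -, hcover⟩ := h (reversedFirst (t + 1)) rfl
  obtain ⟨φ, hφ, u, hu⟩ := Set.mem_iUnion₂.mp (hcover.symm.subset (Set.mem_univ 0))
  exact (hT φ hφ).ne_zero_of_reversedFirst u hu

/-! ### The sequence of tileable graphs -/

/-- The edge-ordered graphs `Fₙ` of the theorem: the parameter of the double broom is chosen so that
it increases exactly in the steps from even to odd `n`, which add a smallest pendant edge. -/
def tileableBroom (n : ℕ) : EdgeOrderedGraph (Fin n) :=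
  doubleBroom ((n - 3) / 2) n

theorem addsSmallestPendant_tileableBroom {n : ℕ} (hn : 4 ≤ n) (hev : Even n) :
    ∃ v, (tileableBroom n).IsMinimalVertex v ∧
      (tileableBroom n).AddsSmallestPendant v (tileableBroom (n + 1)) := by
  obtain ⟨l, rfl⟩ := hev
  obtain ⟨l, rfl⟩ := Nat.exists_eq_add_of_le' (show 2 ≤ l by lia)
  have hk : (l + 2 + (l + 2) - 3) / 2 = l := by lia
  have hk' : (l + 2 + (l + 2) + 1 - 3) / 2 = l + 1 := by lia
  rw [tileableBroom, tileableBroom, hk, hk']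
  exact ⟨_, isMinimalVertex_doubleBroom l _, addsSmallestPendant_doubleBroom l (l + 2 + l)⟩

theorem addsLargestPendant_tileableBroom {n : ℕ} (hn : 4 ≤ n) (hodd : Odd n) :
    ∃ v, (tileableBroom n).IsMaximalVertex v ∧
      (tileableBroom n).AddsLargestPendant v (tileableBroom (n + 1)) := by
  obtain ⟨l, rfl⟩ := hodd
  have hk : (2 * l + 1 - 3) / 2 = l - 1 := by lia
  have hk' : (2 * l + 1 + 1 - 3) / 2 = l - 1 := by lia
  rw [tileableBroom, tileableBroom, hk, hk']
  exact ⟨_, isMaximalVertex_doubleBroom (l - 1) (2 * l), addsLargestPendant_doubleBroom (by lia)⟩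

theorem containsCopy_D4_tileableBroom {n : ℕ} (hn : 4 ≤ n) : (tileableBroom n).ContainsCopy D4 := by
  induction n, hn using Nat.le_induction with
  | base => exact doubleBroom_zero_four ▸ ContainsCopy.refl D4
  | succ n hn ih =>
    rcases n.even_or_odd with hev | hodd
    · obtain ⟨v, -, ι, u, hι, -⟩ := addsSmallestPendant_tileableBroom hn hev
      exact hι.containsCopy.trans ih
    · obtain ⟨v, -, ι, u, hι, -⟩ := addsLargestPendant_tileableBroom hn hodd
      exact hι.containsCopy.trans ih

end EdgeOrderedGraph

open EdgeOrderedGraph in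
theorem corollary2p16 :
    -- the graphs `F n`, `n ≥ 6`, are built from `D₄` by successively adding pendant edges,
    -- alternately a smallest one at a minimal vertex and a largest one at a maximal vertex
    (∃ F : (n : ℕ) → EdgeOrderedGraph (Fin n),
      F 4 = EdgeOrderedGraph.D4 ∧
      (∀ n : ℕ, 4 ≤ n → Even n →
        ∃ v : Fin n, (F n).IsMinimalVertex v ∧ (F n).AddsSmallestPendant v (F (n + 1))) ∧
      (∀ n : ℕ, 4 ≤ n → Odd n →
        ∃ v : Fin n, (F n).IsMaximalVertex v ∧ (F n).AddsLargestPendant v (F (n + 1))) ∧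
      ∀ n : ℕ, 6 ≤ n →
        (F n).graph.Connected ∧ (F n).Tileable ∧
        SimpleGraph.IsContained K4Minus (F n).graph ∧
        (F n).ContainsCopy EdgeOrderedGraph.D4) ∧
    -- the connected edge-ordered graph `D₄` itself is not tileable
    (EdgeOrderedGraph.D4.graph.Connected ∧ ¬ EdgeOrderedGraph.D4.Tileable) ∧
    -- hence tileability is not closed under taking connected subgraphs
    ¬ (∀ (m n : ℕ) (A : EdgeOrderedGraph (Fin m)) (B : EdgeOrderedGraph (Fin n)),
        B.graph.Connected → B.Tileable → B.ContainsCopy A → A.graph.Connected →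
        A.Tileable) := by
  have hconn {n : ℕ} (hn : 4 ≤ n) : (tileableBroom n).graph.Connected :=
    connected_doubleBroom _ n (by lia)
  have htile {n : ℕ} (hn : 6 ≤ n) : (tileableBroom n).Tileable :=
    tileable_doubleBroom (by lia) (by lia)
  have hD4 : D4.graph.Connected := doubleBroom_zero_four ▸ hconn le_rfl
  refine ⟨⟨tileableBroom, doubleBroom_zero_four, fun n hn => addsSmallestPendant_tileableBroom hn,
    fun n hn => addsLargestPendant_tileableBroom hn, fun n hn => ?_⟩, ⟨hD4, not_tileable_D4⟩,
    fun h => ?_⟩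
  · have hcopy := containsCopy_D4_tileableBroom (show 4 ≤ n by lia)
    exact ⟨hconn (by lia), htile hn, K4Minus_eq_graph_D4 ▸ hcopy.isContained, hcopy⟩
  · exact not_tileable_D4 (h 4 6 _ _ (hconn (by lia)) (htile le_rfl)
      (containsCopy_D4_tileableBroom (by lia)) hD4)
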